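/- Let $(Q,\mathfrak m)\to(Q',\mathfrak m')$ be a finite flat extension of regular local rings with $\mathfrak m Q'=\mathfrak m'$. Let $I\subseteq Q$ and $J\subseteq Q'$ be ideals with $IQ'\subseteq J$, where $J$ is generated by a $Q'$-regular sequence (so $J\neq Q'$), and let $\varphi\colon R=Q/I\to S=Q'/J$ be the induced map. Put $V_R=I/\mathfrak m I$; for $f\in I$ let $[f]$ be its class in $V_R$, and for an $R$-module $M\ne 0$ let $$V_R(M)=\{\,v\in V_R \mid v=0,\ \text{or } v=[f] \text{ for some } f\in I \text{ with } \operatorname{pd}_{Q/f}M=\infty\,\}.$$ Then $$V_R(S)=\ker\bigl(I/\mathfrak m I\longrightarrow J/\mathfrak m'J\bigr),$$ where the map is induced by $Q\to Q'$. Moreover, for every nonzero $f\in I$, one has $\operatorname{pd}_{Q/f}(Q'/J)=\infty$ if and only if the image of $f$ in $Q'$ lies in $\mathfrak m'J$. -/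

import Mathlib

open CategoryTheory

universe u

noncomputable section

/-- For an ideal `I` of a local ring `(Q, 𝔪, k)`, the `k`-vector space `V_R = I / 𝔪 I` attached
to `R = Q / I`. (It is written as a `Q`-module; it is killed by `𝔪`, so its `Q`-submodules are
exactly its `k`-subspaces.) -/
abbrev VSpace {Q : Type u} [CommRing Q] [IsLocalRing Q] (I : Ideal Q) : Type u :=
  I ⧸ (IsLocalRing.maximalIdeal Q • ⊤ : Submodule Q I)

/-- The class `[f] ∈ I / 𝔪 I` of an element `f ∈ I`. -/
def VSpace.cls {Q : Type u} [CommRing Q] [IsLocalRing Q] {I : Ideal Q} (f : I) : VSpace I :=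
  Submodule.Quotient.mk f

/-- For `f ∈ I`, the projective dimension `pd_{Q/f} M` of a `Q/I`-module `M`, regarded as a
module over `Q/f` by restriction of scalars along `Q/f → Q/I`. -/
def pdHypersurface {Q : Type u} [CommRing Q] (I : Ideal Q) (f : I)
    (M : ModuleCat.{u} (Q ⧸ I)) : WithBot ℕ∞ :=
  projectiveDimension ((ModuleCat.restrictScalars (Ideal.Quotient.factor
    ((Ideal.span_singleton_le_iff_mem I).2 f.2 : Ideal.span {(f : Q)} ≤ I))).obj M)

/-- The cohomological support `V_R(M) ⊆ V_R` of an `R`-module `M`, where `R = Q / I`: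
the classes `[f]` with `pd_{Q/f} M = ∞` or `[f] = 0`. The support of the zero module is empty.
When `Q` (hence `R`) is complete and `M` is finitely generated, `M` is its own completion, so that
no completion appears. -/
def cohomologicalSupport {Q : Type u} [CommRing Q] [IsLocalRing Q] (I : Ideal Q)
    (M : ModuleCat.{u} (Q ⧸ I)) : Set (VSpace I) :=
  {v | Nontrivial M ∧ ((∃ f : I, VSpace.cls f = v ∧ pdHypersurface I f M = ⊤) ∨ v = 0)}

section Map

variable {Q Q' : Type u} [CommRing Q] [CommRing Q'] [Algebra Q Q']
  {I : Ideal Q} {J : Ideal Q'}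

/-- The ring `S = Q' / J` as a module over `R = Q / I`, along the map `φ : R → S` induced by
`Q → Q'` when `I Q' ⊆ J`. -/
def targetModule (hIJ : I ≤ J.comap (algebraMap Q Q')) : ModuleCat.{u} (Q ⧸ I) :=
  (ModuleCat.restrictScalars (Ideal.quotientMap J (algebraMap Q Q') hIJ)).obj
    (ModuleCat.of (Q' ⧸ J) (Q' ⧸ J))

/-- The map `I → J` obtained by restricting `Q → Q'`. -/
def idealMap (hIJ : I ≤ J.comap (algebraMap Q Q')) : I →ₛₗ[algebraMap Q Q'] J where
  toFun f := ⟨algebraMap Q Q' f, hIJ f.2⟩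
  map_add' f g := Subtype.ext (map_add (algebraMap Q Q') (f : Q) g)
  map_smul' a f := Subtype.ext (map_mul (algebraMap Q Q') a f)

variable [IsLocalRing Q] [IsLocalRing Q']

theorem idealMap_smul_le (hIJ : I ≤ J.comap (algebraMap Q Q'))
    (hm : (IsLocalRing.maximalIdeal Q).map (algebraMap Q Q') = IsLocalRing.maximalIdeal Q') :
    (IsLocalRing.maximalIdeal Q • ⊤ : Submodule Q I) ≤
      (IsLocalRing.maximalIdeal Q' • ⊤ : Submodule Q' J).comap (idealMap hIJ) := by
  refine Submodule.smul_le.2 fun a ha f _ => ?_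
  rw [Submodule.mem_comap, LinearMap.map_smulₛₗ]
  exact Submodule.smul_mem_smul (hm ▸ Ideal.mem_map_of_mem _ ha) trivial

/-- The map `V_φ : I / 𝔪 I → J / 𝔪' J` induced by `Q → Q'`. -/
def VMap (hIJ : I ≤ J.comap (algebraMap Q Q'))
    (hm : (IsLocalRing.maximalIdeal Q).map (algebraMap Q Q') = IsLocalRing.maximalIdeal Q') :
    VSpace I →ₛₗ[algebraMap Q Q'] VSpace J :=
  Submodule.mapQ _ _ (idealMap hIJ) (idealMap_smul_le hIJ hm)

end Map

end

/-! For `f ∈ I` nonzero put `A = Q/f` and `A' = Q'/fQ'`; then `A'` is free over `A` and `𝔪_A`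
generates `𝔪_{A'}`. If `f ∉ 𝔪'J`, then `f` is a minimal generator of `J` and starts a regular
sequence generating `J`. So `Q'/J` is `A'` cut by a regular sequence, and each cut raises the
projective dimension over `A` by at most one.

If `f = ∑ aᵢ gᵢ` with `aᵢ ∈ 𝔪'` and `gᵢ ∈ J`, a Koszul-type matrix factorization `D² = f` is
square-zero and exact over `A'`. Exactness passes to every finite `A'`-module of finite projective
dimension over `A` (`Matrix.ExactOn.of_hasProjectiveDimensionLE`): syzygies over `A'` eventually
become `A`-projective, hence `A'`-free. But on `Q'/J` some basis vector is a cycle, as its column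
lies in `J`, and not a boundary, as its row lies in `𝔪'`.

Exactness of `D` over `A'` needs `f` to be a non-zero-divisor in `Q'`; this holds because `Q'` is a
domain and `Q → Q'` is injective. -/

open IsLocalRing RingTheory.Sequence
open scoped Pointwise Matrix.Module

/-! ### Exchange of generators -/

/-- An element of an ideal `(g)` of a local ring that is not in `𝔪 (g)` can be exchanged for one of
the generators. -/
theorem exists_perm_cons_of_notMem_maximalIdeal_mul {R : Type*} [CommRing R] [IsLocalRing R] {f : R}
    {g : List R} (hf : f ∈ Ideal.ofList g) (hf' : f ∉ maximalIdeal R * Ideal.ofList g) :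
    ∃ (b u : R) (g' : List R), IsUnit u ∧ g.Perm (b :: g') ∧ f - u * b ∈ Ideal.ofList g' := by
  induction g generalizing f with
  | nil =>
    rw [Ideal.ofList_nil, Ideal.mem_bot] at hf
    exact absurd (hf ▸ Ideal.zero_mem _) hf'
  | cons x g ih =>
    rw [Ideal.ofList_cons] at hf hf'
    obtain ⟨y, hy, z, hz, rfl⟩ := Submodule.mem_sup.1 hf
    obtain ⟨a, rfl⟩ := Ideal.mem_span_singleton'.1 hy
    by_cases ha : IsUnit a
    · exact ⟨x, a, g, ha, List.Perm.refl _, by simpa using hz⟩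
    -- A non-unit coefficient contributes only to `𝔪 (g)`, so the hypothesis passes to the tail.
    · have hax : a * x ∈ maximalIdeal R * (Ideal.span {x} ⊔ Ideal.ofList g) :=
        Ideal.mul_mem_mul ((mem_maximalIdeal a).2 ha)
          (Ideal.mem_sup_left (Ideal.mem_span_singleton_self x))
      obtain ⟨b, u, g', hu, hp, h⟩ := ih hz fun h => hf' <| Ideal.add_mem _ hax
        (Ideal.mul_mono_right le_sup_right h)
      refine ⟨b, u, x :: g', hu, (hp.cons x).trans (List.Perm.swap b x g'), ?_⟩
      rw [Ideal.ofList_cons, add_sub_assoc]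
      exact Ideal.add_mem _ (Ideal.mem_sup_left hy) (Ideal.mem_sup_right h)

theorem Ideal.ofList_perm {R : Type*} [CommRing R] {g g' : List R} (h : g.Perm g') :
    Ideal.ofList g = Ideal.ofList g' :=
  congrArg Ideal.span (Set.ext fun _ => h.mem_iff)

theorem Ideal.ofList_cons_eq_of_sub_mem {R : Type*} [CommRing R] {f b u : R} {g : List R}
    (hu : IsUnit u) (h : f - u * b ∈ Ideal.ofList g) :
    Ideal.ofList (f :: g) = Ideal.ofList (b :: g) := by
  obtain ⟨u, rfl⟩ := hu
  rw [Ideal.ofList_cons, Ideal.ofList_cons]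
  apply le_antisymm <;> refine sup_le ?_ le_sup_right <;> rw [Ideal.span_singleton_le_iff_mem]
  · rw [← sub_add_cancel f (u * b)]
    exact Ideal.add_mem _ (Ideal.mem_sup_right h)
      (Ideal.mem_sup_left (Ideal.mul_mem_left _ _ (Ideal.mem_span_singleton_self b)))
  · have : b = ↑u⁻¹ * f - ↑u⁻¹ * (f - u * b) := by
      rw [mul_sub, sub_sub_cancel, Units.inv_mul_cancel_left]
    rw [this]
    exact Ideal.sub_mem _ (Ideal.mem_sup_left (Ideal.mul_mem_left _ _
      (Ideal.mem_span_singleton_self f))) (Ideal.mem_sup_right (Ideal.mul_mem_left _ _ h))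

theorem Ideal.spanFinrank_ofList_le {R : Type*} [CommRing R] (g : List R) :
    (Ideal.ofList g).spanFinrank ≤ g.length := by
  classical
  have h : {r | r ∈ g} = (g.toFinset : Set R) := by ext; simp
  refine (Submodule.spanFinrank_span_le_ncard_of_finite (h ▸ g.toFinset.finite_toSet)).trans ?_
  rw [h, Set.ncard_coe_finset]
  exact g.toFinset_card_le

/-! ### Regular local rings are domains -/

/-- Cutting a regular local ring by an element of `𝔪 \ 𝔪²` gives a regular local ring, whose
maximal ideal needs fewer generators. -/
theorem IsRegularLocalRing.quotient_span_singleton {R : Type*} [CommRing R] [IsRegularLocalRing R]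
    {x : R} (hx : x ∈ maximalIdeal R) (hx' : x ∉ maximalIdeal R * maximalIdeal R) :
    IsRegularLocalRing (R ⧸ Ideal.span {x}) ∧ ∀ _ : IsLocalRing (R ⧸ Ideal.span {x}),
      (maximalIdeal (R ⧸ Ideal.span {x})).spanFinrank < (maximalIdeal R).spanFinrank := by
  have hne : Ideal.span {x} ≠ ⊤ := fun h => (maximalIdeal.isMaximal R).ne_top <|
    top_le_iff.1 (h ▸ (Ideal.span_singleton_le_iff_mem _).2 hx)
  have : Nontrivial (R ⧸ Ideal.span {x}) := Ideal.Quotient.nontrivial_iff.2 hne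
  have : IsLocalRing (R ⧸ Ideal.span {x}) :=
    IsLocalRing.of_surjective' _ Ideal.Quotient.mk_surjective
  obtain ⟨s, hs, hsm⟩ := Submodule.FG.exists_span_finset_card_eq_spanFinrank
    (IsNoetherian.noetherian (maximalIdeal R))
  have hg : Ideal.ofList s.toList = maximalIdeal R := by
    rw [← hsm]
    exact congrArg Ideal.span (Set.ext fun _ => Finset.mem_toList)
  obtain ⟨b, u, g', hu, hp, h⟩ := exists_perm_cons_of_notMem_maximalIdeal_mul (f := x)
    (g := s.toList) (hg.symm ▸ hx) (hg.symm ▸ hx')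
  have hg' : Ideal.ofList (x :: g') = maximalIdeal R := by
    rw [Ideal.ofList_cons_eq_of_sub_mem hu h, ← Ideal.ofList_perm hp, hg]
  have hlen : g'.length + 1 = (maximalIdeal R).spanFinrank := by
    rw [← hs, ← s.length_toList, hp.length_eq, List.length_cons]
  have hmax : maximalIdeal (R ⧸ Ideal.span {x}) =
      Ideal.ofList (g'.map (Ideal.Quotient.mk (Ideal.span {x}))) := by
    rw [← IsLocalRing.map_maximalIdeal_of_surjective _ Ideal.Quotient.mk_surjective, ← hg',
      Ideal.map_ofList, List.map_cons, Ideal.ofList_cons,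
      Ideal.Quotient.eq_zero_iff_mem.2 (Ideal.mem_span_singleton_self x)]
    simp
  have hle : (maximalIdeal (R ⧸ Ideal.span {x})).spanFinrank ≤ g'.length := by
    rw [hmax]
    simpa using Ideal.spanFinrank_ofList_le (g'.map (Ideal.Quotient.mk (Ideal.span {x})))
  refine ⟨IsRegularLocalRing.of_spanFinrank_maximalIdeal_le _ ?_, fun _ => by lia⟩
  -- The number of generators has dropped by one, and the dimension drops by at most one.
  have hdim := Ideal.height_le_ringKrullDim_quotient_add_one hx
  rw [IsLocalRing.maximalIdeal_height_eq_ringKrullDim,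
    ← IsRegularLocalRing.spanFinrank_maximalIdeal, ← hlen] at hdim
  refine le_trans (b := (g'.length : WithBot ℕ∞)) (by exact_mod_cast hle) ?_
  push_cast at hdim
  exact ENat.WithBot.add_le_add_one_right_iff.1 hdim

/-- Choose `x ∈ 𝔪` outside `𝔪²` and all minimal primes. By induction `(x)` is prime, so it contains
a minimal prime `p`. As `x ∉ p`, one gets `p = xp`, and Nakayama gives `p = 0`. -/
theorem IsRegularLocalRing.isDomain_of_spanFinrank_le (n : ℕ) : ∀ (R : Type u) [CommRing R]
    [IsRegularLocalRing R], (maximalIdeal R).spanFinrank ≤ n → IsDomain R := by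
  induction n with
  | zero =>
    intro R _ _ h
    have h0 := (Submodule.spanFinrank_eq_zero_iff_eq_bot
      (IsNoetherian.noetherian (maximalIdeal R))).1 (Nat.le_zero.1 h)
    exact (IsLocalRing.isField_iff_maximalIdeal_eq.2 h0).isDomain
  | succ n ih =>
    intro R _ _ h
    by_cases h0 : maximalIdeal R = ⊥
    · exact (IsLocalRing.isField_iff_maximalIdeal_eq.2 h0).isDomain
    have hfin := minimalPrimes.finite_of_isNoetherianRing R
    have key : ¬ ((maximalIdeal R : Set R) ⊆
        ⋃ i ∈ ((insert (maximalIdeal R * maximalIdeal R) hfin.toFinset : Finset (Ideal R)) :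
          Set (Ideal R)), (id i : Ideal R)) := by
      classical
      -- Prime avoidance tolerates two non-prime ideals; both slots go to `𝔪²`.
      rw [Ideal.subset_union_prime (maximalIdeal R * maximalIdeal R)
        (maximalIdeal R * maximalIdeal R)]
      · rintro ⟨p, hp, hle⟩
        rcases Finset.mem_insert.1 hp with rfl | hp
        · exact h0 (Submodule.eq_bot_of_le_smul_of_le_jacobson_bot _ _
            (IsNoetherian.noetherian _) hle (IsLocalRing.maximalIdeal_le_jacobson _))
        · have hp := hfin.mem_toFinset.1 hp
          have : p.IsPrime := hp.1.1
          have hpm : p = maximalIdeal R := le_antisymm (le_maximalIdeal hp.1.1.ne_top) hle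
          have h1 : (maximalIdeal R).height = 0 := by
            rw [← hpm]
            exact Ideal.height_eq_zero_iff.2 hp
          have h2 := IsRegularLocalRing.spanFinrank_maximalIdeal (R := R)
          rw [← IsLocalRing.maximalIdeal_height_eq_ringKrullDim, h1] at h2
          exact h0 ((Submodule.spanFinrank_eq_zero_iff_eq_bot
            (IsNoetherian.noetherian (maximalIdeal R))).1 (by exact_mod_cast h2))
      · intro p hp hne _
        exact (hfin.mem_toFinset.1 ((Finset.mem_insert.1 hp).resolve_left hne)).1.1
    obtain ⟨x, hx, hxU⟩ := Set.not_subset.1 key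
    simp only [Finset.coe_insert, Set.mem_iUnion, not_exists] at hxU
    have hx2 : x ∉ maximalIdeal R * maximalIdeal R := fun h => hxU _ (Set.mem_insert _ _) h
    obtain ⟨hreg, hlt⟩ := IsRegularLocalRing.quotient_span_singleton hx hx2
    have hdom := ih (R ⧸ Ideal.span {x}) (by have := hlt inferInstance; lia)
    have hprime := (Ideal.Quotient.isDomain_iff_prime _).1 hdom
    obtain ⟨p, hp, hpx⟩ := Ideal.exists_minimalPrimes_le (bot_le (a := Ideal.span {x}))
    have hxp : x ∉ p := fun h => hxU p
      (Set.mem_insert_of_mem _ (by simpa using hp)) h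
    have hp' : p.IsPrime := hp.1.1
    have hbot : p = ⊥ := by
      refine Submodule.eq_bot_of_le_smul_of_le_jacobson_bot (maximalIdeal R) _
        (IsNoetherian.noetherian _) ?_ (IsLocalRing.maximalIdeal_le_jacobson _)
      intro y hy
      obtain ⟨z, rfl⟩ := Ideal.mem_span_singleton'.1 (hpx hy)
      rw [mul_comm]
      exact Submodule.smul_mem_smul hx ((hp'.mem_or_mem hy).resolve_right hxp)
    rw [hbot] at hp'
    exact IsDomain.of_bot_isPrime R

theorem IsRegularLocalRing.isDomain (R : Type u) [CommRing R] [IsRegularLocalRing R] :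
    IsDomain R :=
  isDomain_of_spanFinrank_le _ R le_rfl

/-! ### Matrix factorizations and exactness -/

namespace Matrix

/-- A square matrix `D` over `R` is exact on an `R`-module `M` if every vector over `M` that is
killed by `D` is in the image of `D`. -/
def ExactOn {ι R : Type*} [Fintype ι] [DecidableEq ι] [CommRing R] (D : Matrix ι ι R) (M : Type*)
    [AddCommGroup M] [Module R M] : Prop :=
  ∀ x : ι → M, D • x = 0 → ∃ y : ι → M, D • y = x

section ExactOn

variable {ι R : Type*} [Fintype ι] [DecidableEq ι] [CommRing R] {D : Matrix ι ι R}
  {M N : Type*} [AddCommGroup M] [Module R M] [AddCommGroup N] [Module R N]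

theorem ExactOn.of_linearEquiv (h : D.ExactOn M) (e : M ≃ₗ[R] N) : D.ExactOn N := by
  intro x hx
  obtain ⟨y, hy⟩ := h (e.symm.toLinearMap.mapMatrixModule ι x) (by
    rw [← map_smul, hx, map_zero])
  refine ⟨e.toLinearMap.mapMatrixModule ι y, ?_⟩
  rw [← map_smul, hy]
  ext i
  simp

theorem ExactOn.pi {κ : Type*} (h : D.ExactOn M) : D.ExactOn (κ → M) := by
  intro x hx
  have (k : κ) : ∃ y : ι → M, D • y = fun i => x i k := h _ <| by
    ext i
    simpa using congrFun (congrFun hx i) k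
  choose y hy using this
  refine ⟨fun i k => y k i, ?_⟩
  ext i k
  simpa using congrFun (hy k) i

/-- This is a piece of the long exact homology sequence: lift a cycle, correct the lift by an
element of the kernel so that it becomes a cycle of `M`, and push its primitive down. -/
theorem ExactOn.of_surjective (hD : D * D = 0) {π : M →ₗ[R] N} (hπ : Function.Surjective π)
    (hM : D.ExactOn M) (hK : D.ExactOn (LinearMap.ker π)) : D.ExactOn N := by
  intro x hx
  choose s hs using hπ
  have hxs : π.mapMatrixModule ι (fun i => s (x i)) = x := by ext i; simp [hs]
  have hmem (i : ι) : (D • fun i => s (x i)) i ∈ LinearMap.ker π := by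
    rw [LinearMap.mem_ker]
    have := congrFun (map_smul (π.mapMatrixModule ι) D (fun i => s (x i))) i
    rw [hxs, hx] at this
    exact this
  have hsub (k : ι → LinearMap.ker π) :
      D • (LinearMap.ker π).subtype.mapMatrixModule ι k =
        (LinearMap.ker π).subtype.mapMatrixModule ι (D • k) := (map_smul _ _ _).symm
  have hinj : Function.Injective ((LinearMap.ker π).subtype.mapMatrixModule (R := R) ι) := by
    intro a b hab
    ext i
    exact congrFun hab i
  obtain ⟨k, hk⟩ := hK (fun i => ⟨_, hmem i⟩) <| hinj <| by
    rw [← hsub, map_zero]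
    change D • D • (fun i => s (x i)) = 0
    rw [← mul_smul, hD, zero_smul]
  obtain ⟨y, hy⟩ := hM ((fun i => s (x i)) - (LinearMap.ker π).subtype.mapMatrixModule ι k) <| by
    rw [smul_sub, hsub, hk, sub_eq_zero]
    rfl
  refine ⟨π.mapMatrixModule ι y, ?_⟩
  rw [← map_smul, hy, map_sub, hxs, sub_eq_self]
  ext i
  simp

/-- A matrix factorization of a non-zero-divisor `f` is exact modulo `f`. -/
theorem ExactOn.quotient_of_mul_self_eq {f : R} (hf : f ∈ nonZeroDivisors R)
    (hD : D * D = Matrix.scalar ι f) {I : Ideal R} (hI : I = Ideal.span {f}) :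
    (D.map (Ideal.Quotient.mk I)).ExactOn (R ⧸ I) := by
  have hmk (x : ι → R) : D.map (Ideal.Quotient.mk I) • (fun i => Ideal.Quotient.mk I (x i)) =
      fun i => Ideal.Quotient.mk I ((D • x) i) := by
    ext i
    simp [Matrix.Module.smul_apply]
  intro x hx
  choose s hs using Ideal.Quotient.mk_surjective (I := I)
  have hxs : (fun i => Ideal.Quotient.mk I (s (x i))) = x := by ext i; simp [hs]
  rw [← hxs, hmk] at hx
  have (i : ι) : ∃ w, w * f = (D • fun i => s (x i)) i := by
    rw [← Ideal.mem_span_singleton', ← hI, ← Ideal.Quotient.eq_zero_iff_mem]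
    exact congrFun hx i
  choose w hw using this
  refine ⟨fun i => Ideal.Quotient.mk I (w i), ?_⟩
  rw [hmk, ← hxs]
  ext i
  congr 1
  -- For the lift `s` of `x`, `D s = f w` gives `D (D w) = f w = D s`. Applying `D` again, `f (D w -
  -- s) = 0`, and `f` cancels.
  have hw' : D • (fun i => s (x i)) = f • w := by
    ext i
    rw [← hw, Pi.smul_apply, smul_eq_mul, mul_comm]
  have h0 : D • D • w = D • (fun i => s (x i)) := by
    rw [hw', ← mul_smul, hD, Matrix.Module.scalar_smul]
  have h1 : f • (D • w - fun i => s (x i)) = 0 := by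
    rw [← Matrix.Module.scalar_smul, ← hD, mul_smul, smul_sub, h0, sub_self, smul_zero]
  have h2 := congrFun h1 i
  rw [Pi.smul_apply, Pi.sub_apply, smul_eq_mul, Pi.zero_apply, mul_comm] at h2
  exact sub_eq_zero.1 (mul_right_mem_nonZeroDivisors_eq_zero_iff hf |>.1 h2)

end ExactOn

/-- Adding `a * g` to the square of a matrix by doubling its size. -/
theorem fromBlocks_mul_self_eq_scalar {ι R : Type*} [Fintype ι] [DecidableEq ι] [CommRing R]
    {D : Matrix ι ι R} {f : R} (hD : D * D = Matrix.scalar ι f) (a g : R) :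
    fromBlocks D (Matrix.scalar ι g) (Matrix.scalar ι a) (-D) *
      fromBlocks D (Matrix.scalar ι g) (Matrix.scalar ι a) (-D) =
        Matrix.scalar (ι ⊕ ι) (f + a * g) := by
  have hc (r : R) : Matrix.scalar ι r * D = D * Matrix.scalar ι r :=
    (Matrix.scalar_commute r (Commute.all r) D).eq
  rw [fromBlocks_multiply, mul_neg, hc, add_neg_cancel, neg_mul, hc, add_neg_cancel, neg_mul_neg,
    hD, ← map_mul, ← map_mul, ← map_add, ← map_add, mul_comm g a, add_comm (a * g) f]
  ext (i | i) (j | j) <;> simp [Matrix.diagonal_apply]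

/-- Elements of a product of ideals `I * K` have matrix factorizations with a distinguished basis
vector whose row lies in `I` and whose column lies in `K`. -/
theorem exists_mul_self_eq_scalar_of_mem_mul {R : Type u} [CommRing R] {I K : Ideal R} {f : R}
    (hf : f ∈ I * K) : ∃ (ι : Type) (_ : Fintype ι) (_ : DecidableEq ι) (D : Matrix ι ι R) (o : ι),
      D * D = Matrix.scalar ι f ∧ (∀ j, D o j ∈ I) ∧ ∀ j, D j o ∈ K := by
  -- Factorizations of two summands do not simply add, so the induction shows instead that `f` can
  -- be added to any `h` already factored.
  suffices H : ∀ h : R, (∃ (ι : Type) (_ : Fintype ι) (_ : DecidableEq ι) (D : Matrix ι ι R)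
      (o : ι), D * D = Matrix.scalar ι h ∧ (∀ j, D o j ∈ I) ∧ ∀ j, D j o ∈ K) →
      ∃ (ι : Type) (_ : Fintype ι) (_ : DecidableEq ι) (D : Matrix ι ι R)
      (o : ι), D * D = Matrix.scalar ι (h + f) ∧ (∀ j, D o j ∈ I) ∧ ∀ j, D j o ∈ K by
    rw [← zero_add f]
    exact H 0 ⟨Unit, inferInstance, inferInstance, 0, (), by simp, by simp, by simp⟩
  refine Submodule.mul_induction_on hf ?_ ?_
  · rintro a ha g hg h ⟨ι, _, _, D, o, hD, hI, hK⟩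
    -- The copy `Sum.inr o` has `a` in its row and `g` in its column; `Sum.inl o` would exchange
    -- them.
    refine ⟨ι ⊕ ι, inferInstance, inferInstance, _, Sum.inr o,
      fromBlocks_mul_self_eq_scalar hD a g, ?_, ?_⟩
    · rintro (j | j)
      · by_cases h : o = j <;> simp [h, ha]
      · simpa using hI j
    · rintro (j | j)
      · by_cases h : j = o <;> simp [h, hg]
      · simpa using hK j
  · intro x y hx hy h hh
    rw [← add_assoc]
    exact hy _ (hx _ hh)

/-- If the row of a basis vector lies in the maximal ideal and its column kills a nonzero quotient
`S` of a local ring, the matrix is not exact on `S`. -/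
theorem not_exactOn_quotient {ι R : Type*} [Fintype ι] [DecidableEq ι] [CommRing R]
    [IsLocalRing R] {D : Matrix ι ι R} {o : ι} {S : Type*} [CommRing S] [Algebra R S]
    [Nontrivial S] (hS : Function.Surjective (algebraMap R S))
    (hI : ∀ j, D o j ∈ maximalIdeal R) (hK : ∀ j, algebraMap R S (D j o) = 0) :
    ¬ D.ExactOn S := by
  intro h
  have : IsLocalRing S := IsLocalRing.of_surjective' _ hS
  have : IsLocalHom (algebraMap R S) := .of_surjective _ hS
  obtain ⟨y, hy⟩ := h (Pi.single o 1) <| by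
    ext i
    rw [Matrix.Module.smul_apply, Finset.sum_eq_single o]
    · simp [Algebra.smul_def, hK]
    · intro j _ hj
      simp [hj]
    · simp
  have h1 : (1 : S) ∈ maximalIdeal S := by
    have := congrFun hy o
    rw [Pi.single_eq_same, Matrix.Module.smul_apply] at this
    rw [← this]
    refine Ideal.sum_mem _ fun j _ => ?_
    rw [Algebra.smul_def]
    exact Ideal.mul_mem_right _ _ ((map_mem_nonunits_iff (algebraMap R S) _).2 (hI j))
  exact (Ideal.ne_top_iff_one _).1 (maximalIdeal.isMaximal S).ne_top h1

end Matrix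

/-! ### Minimal covers and finite projective dimension -/

/-- Finite modules over a local ring have minimal covers. -/
theorem exists_surjective_ker_le_maximalIdeal_smul (R : Type*) [CommRing R] [IsLocalRing R]
    (M : Type*) [AddCommGroup M] [Module R M] [Module.Finite R M] :
    ∃ (n : ℕ) (π : (Fin n → R) →ₗ[R] M), Function.Surjective π ∧
      LinearMap.ker π ≤ maximalIdeal R • ⊤ := by
  classical
  obtain ⟨n, v, hv, hmin⟩ : ∃ (n : ℕ) (v : Fin n → M), Submodule.span R (Set.range v) = ⊤ ∧
      ∀ k < n, ¬ ∃ w : Fin k → M, Submodule.span R (Set.range w) = ⊤ := by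
    have hex := Module.Finite.exists_fin (R := R) (M := M)
    obtain ⟨v, hv⟩ := Nat.find_spec hex
    exact ⟨_, v, hv, fun k hk => Nat.find_min hex hk⟩
  refine ⟨n, Fintype.linearCombination R v, ?_, ?_⟩
  · rw [← LinearMap.range_eq_top, Fintype.range_linearCombination, hv]
  · intro x hx
    -- A unit coordinate of a relation would make one generator redundant.
    have hmem (i : Fin n) : x i ∈ maximalIdeal R := by
      by_contra hi
      rw [mem_maximalIdeal, mem_nonunits_iff, not_not] at hi
      obtain ⟨c, hc⟩ := hi
      obtain ⟨k, hk⟩ : ∃ k, n = k + 1 := ⟨n - 1, by have := i.2; lia⟩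
      subst hk
      refine hmin k (by lia) ⟨fun j => v (i.succAbove j), ?_⟩
      rw [eq_top_iff, ← hv, Submodule.span_le]
      rintro _ ⟨j, rfl⟩
      rcases Fin.eq_self_or_eq_succAbove i j with rfl | ⟨j, rfl⟩
      · rw [LinearMap.mem_ker, Fintype.linearCombination_apply, Fin.sum_univ_succAbove _ j, ← hc,
          ← Units.smul_def, add_eq_zero_iff_eq_neg] at hx
        rw [← inv_smul_smul c (v j), hx, SetLike.mem_coe, Units.smul_def]
        exact Submodule.smul_mem _ _ (Submodule.neg_mem _ (Submodule.sum_mem _ fun l _ =>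
          Submodule.smul_mem _ _ (Submodule.subset_span ⟨l, rfl⟩)))
      · exact Submodule.subset_span ⟨j, rfl⟩
    rw [pi_eq_sum_univ' x]
    exact Submodule.sum_mem _ fun i _ => Submodule.smul_mem_smul (hmem i) trivial

section

variable {A A' : Type u} [CommRing A] [CommRing A'] [Algebra A A'] [IsLocalRing A'] [IsLocalRing A]

/-- A minimal cover over `A'` of a module which is projective over `A` is injective, if `𝔪_A`
generates `𝔪_{A'}`. -/
theorem ker_eq_bot_of_projective_of_ker_le [IsNoetherianRing A']
    (hm : (maximalIdeal A).map (algebraMap A A') = maximalIdeal A')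
    {F M : Type*} [AddCommGroup F] [Module A' F] [Module A F] [IsScalarTower A A' F]
    [AddCommGroup M] [Module A' M] [Module A M] [IsScalarTower A A' M]
    [Module.Finite A' F] [Module.Projective A M] {π : F →ₗ[A'] M} (hπ : Function.Surjective π)
    (hker : LinearMap.ker π ≤ maximalIdeal A' • ⊤) : LinearMap.ker π = ⊥ := by
  obtain ⟨σ, hσ⟩ := Module.projective_lifting_property (π.restrictScalars A) LinearMap.id hπ
  have hσ' (x : M) : π (σ x) = x := LinearMap.congr_fun hσ x
  -- The projection `p` onto `ker π` is only `A`-linear, but still maps `𝔪' F` into `𝔪' ker π`,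
  -- because `𝔪'` is generated from `A`. As `p` fixes `ker π ≤ 𝔪' F`, Nakayama applies.
  let p : F →ₗ[A] F := LinearMap.id - σ ∘ₗ π.restrictScalars A
  have hp (x : F) : p x = x - σ (π x) := rfl
  have hpK (x : F) : p x ∈ LinearMap.ker π := by
    rw [LinearMap.mem_ker, hp, map_sub, hσ', sub_self]
  have hsmul (r : A') (hr : r ∈ maximalIdeal A') :
      ∀ z : F, p (r • z) ∈ maximalIdeal A' • LinearMap.ker π := by
    rw [← hm] at hr
    refine Submodule.span_induction ?_ ?_ ?_ ?_ hr
    · rintro _ ⟨c, hc, rfl⟩ z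
      rw [algebraMap_smul, map_smul, ← algebraMap_smul A' c (p z)]
      exact Submodule.smul_mem_smul (hm ▸ Ideal.mem_map_of_mem _ hc) (hpK z)
    · intro z
      simp
    · intro a b _ _ ha hb z
      rw [add_smul, map_add]
      exact Submodule.add_mem _ (ha z) (hb z)
    · intro a b _ hb z
      rw [smul_eq_mul, mul_comm, mul_smul]
      exact hb _
  have hle (y : F) (hy : y ∈ (maximalIdeal A' • ⊤ : Submodule A' F)) :
      p y ∈ maximalIdeal A' • LinearMap.ker π := by
    refine Submodule.smul_induction_on hy (fun r hr z _ => hsmul r hr z) fun a b ha hb => ?_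
    rw [map_add]
    exact Submodule.add_mem _ ha hb
  refine Submodule.eq_bot_of_le_smul_of_le_jacobson_bot (maximalIdeal A') _
    (IsNoetherian.noetherian _) (fun x hx => ?_) (IsLocalRing.maximalIdeal_le_jacobson _)
  have := hle x (hker hx)
  rwa [hp, LinearMap.mem_ker.1 hx, map_zero, sub_zero] at this

/-- A square-zero matrix over `A'` that is exact on `A'` is exact on all finite `A'`-modules that
have finite projective dimension over `A`, if `A'` is free over `A` and `𝔪_A` generates
`𝔪_{A'}`. -/
theorem Matrix.ExactOn.of_hasProjectiveDimensionLE [IsNoetherianRing A'] [Module.Free A A']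
    (hm : (maximalIdeal A).map (algebraMap A A') = maximalIdeal A')
    {ι : Type*} [Fintype ι] [DecidableEq ι] {D : Matrix ι ι A'} (hD : D * D = 0)
    (hA' : D.ExactOn A') (n : ℕ) :
    ∀ (M : Type u) [AddCommGroup M] [Module A' M] [Module A M] [IsScalarTower A A' M]
      [Module.Finite A' M], HasProjectiveDimensionLE (ModuleCat.of A M) n → D.ExactOn M := by
  induction n with
  | zero =>
    intro M _ _ _ _ _ h
    have hM : Module.Projective A M := by
      rwa [IsProjective.iff_projective, projective_iff_hasProjectiveDimensionLE_zero]
    obtain ⟨n, π, hπ, hker⟩ := exists_surjective_ker_le_maximalIdeal_smul A' M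
    exact hA'.pi.of_linearEquiv (LinearEquiv.ofBijective π ⟨LinearMap.ker_eq_bot.1
      (ker_eq_bot_of_projective_of_ker_le hm hπ hker), hπ⟩)
  | succ n ih =>
    intro M _ _ _ _ _ h
    obtain ⟨r, π, hπ, -⟩ := exists_surjective_ker_le_maximalIdeal_smul A' M
    -- As `A'` is free over `A`, the kernel is also a syzygy over `A`, of smaller projective
    -- dimension bound.
    refine Matrix.ExactOn.of_surjective hD hπ hA'.pi (ih (LinearMap.ker π) ?_)
    have hS := (π.restrictScalars A).shortExact_shortComplexKer hπ
    have hF : Projective (ModuleCat.of A (Fin r → A')) :=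
      (IsProjective.iff_projective (Fin r → A')).1 inferInstance
    exact (hS.hasProjectiveDimensionLT_X₃_iff n hF).1 h

end

/-! ### Regular sequences -/

/-- Cutting an `A'`-module by a regular sequence of `A'` keeps the projective dimension over `A`
finite. -/
theorem exists_hasProjectiveDimensionLE_quotient_ofList_smul_top {A A' : Type u} [CommRing A]
    [CommRing A'] [Algebra A A'] (xs : List A') :
    ∀ (M : Type u) [AddCommGroup M] [Module A' M] [Module A M] [IsScalarTower A A' M] (n : ℕ),
      RingTheory.Sequence.IsWeaklyRegular M xs → HasProjectiveDimensionLE (ModuleCat.of A M) n →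
      ∃ m, HasProjectiveDimensionLE
        (ModuleCat.of A (M ⧸ (Ideal.ofList xs • ⊤ : Submodule A' M))) m := by
  induction xs with
  | nil =>
    intro M _ _ _ _ n _ h
    let e : M ≃ₗ[A'] (M ⧸ (Ideal.ofList ([] : List A') • ⊤ : Submodule A' M)) :=
      (Submodule.quotEquivOfEqBot _ (by simp)).symm
    exact ⟨n, hasProjectiveDimensionLT_of_iso (e.restrictScalars A).toModuleIso _⟩
  | cons x xs ih =>
    intro M _ _ _ _ n hreg h
    rw [RingTheory.Sequence.isWeaklyRegular_cons_iff] at hreg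
    let i : M →ₗ[A] M := (LinearMap.lsmul A' M x).restrictScalars A
    let p : M →ₗ[A] QuotSMulTop x M := (Submodule.mkQ (x • (⊤ : Submodule A' M))).restrictScalars A
    have hi : Function.Injective i := hreg.1
    have hp : Function.Surjective p := Submodule.mkQ_surjective (x • (⊤ : Submodule A' M))
    have hip : Function.Exact i p := fun y => by
      refine (Submodule.Quotient.mk_eq_zero _).trans ?_
      simp [i, Submodule.mem_smul_pointwise_iff_exists]
    have hS : (ShortComplex.mk (ModuleCat.ofHom i) (ModuleCat.ofHom p)
        (ModuleCat.hom_ext hip.linearMap_comp_eq_zero)).ShortExact :=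
      ModuleCat.shortComplex_shortExact _ hip hi hp
    -- `HasProjectiveDimensionLE` with bound `k` is `HasProjectiveDimensionLT` with `k + 1`: the
    -- bound grows from `n` to `n + 1`.
    have h' := hS.hasProjectiveDimensionLT_X₃ (n + 1) h
      (hasProjectiveDimensionLT_of_ge _ (n + 1) _ (by lia))
    obtain ⟨m, hm⟩ := ih (QuotSMulTop x M) (n + 1) hreg.2 h'
    exact ⟨m, hasProjectiveDimensionLT_of_iso
      ((Submodule.quotOfListConsSMulTopEquivQuotSMulTopInner M x xs).symm.restrictScalars
        A).toModuleIso _⟩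

/-- In a Noetherian local ring, an element of `(g) \ 𝔪 (g)`, where `g` is a regular sequence, is the
first member of a regular sequence that generates `(g)`. -/
theorem exists_isWeaklyRegular_cons_of_notMem {R : Type*} [CommRing R] [IsLocalRing R]
    [IsNoetherianRing R] {g : List R} (hg : IsRegular R g) {f : R} (hf : f ∈ Ideal.ofList g)
    (hf' : f ∉ maximalIdeal R * Ideal.ofList g) :
    ∃ g' : List R, IsWeaklyRegular R (f :: g') ∧ Ideal.ofList (f :: g') = Ideal.ofList g := by
  obtain ⟨b, u, g', hu, hp, h⟩ := exists_perm_cons_of_notMem_maximalIdeal_mul hf hf'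
  have hmax : Ideal.ofList g ≤ maximalIdeal R := le_maximalIdeal fun h => hg.top_ne_smul <| by
    rw [h, Submodule.top_smul]
  have hIdeal : Ideal.ofList (f :: g') = Ideal.ofList g := by
    rw [Ideal.ofList_cons_eq_of_sub_mem hu h, ← Ideal.ofList_perm hp]
  refine ⟨g', ?_, hIdeal⟩
  -- With `b` moved last, `f` can replace it: modulo `g'` they differ by the unit `u`. Permuting
  -- back puts `f` first.
  have hreg := (IsLocalRing.isRegular_of_perm hg
    (hp.trans (List.perm_append_singleton b g').symm)).toIsWeaklyRegular
  rw [isWeaklyRegular_append_iff, isWeaklyRegular_singleton_iff] at hreg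
  refine IsLocalRing.isWeaklyRegular_of_perm_of_subset_maximalIdeal (rs := g' ++ [f]) ?_
    (List.perm_append_singleton f g') fun r hr => hmax (hIdeal ▸ Ideal.subset_span
      ((List.perm_append_singleton f g').mem_iff.1 hr))
  rw [isWeaklyRegular_append_iff, isWeaklyRegular_singleton_iff]
  refine ⟨hreg.1, fun x y hxy => hreg.2 (hu.isSMulRegular _ ?_)⟩
  have hfb (z : R ⧸ (Ideal.ofList g' • ⊤ : Submodule R R)) : f • z = u • b • z := by
    obtain ⟨z, rfl⟩ := Submodule.mkQ_surjective _ z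
    rw [← sub_eq_zero, ← mul_smul, ← sub_smul, ← map_smul]
    exact (Submodule.Quotient.mk_eq_zero _).2 (Submodule.smul_mem_smul h trivial)
  simpa only [hfb] using hxy

/-! ### Projective dimension over a hypersurface -/

section Hypersurface

variable {Q Q' : Type u} [CommRing Q] [CommRing Q'] [Algebra Q Q']

theorem Ideal.map_algebraMap_span_singleton (f : Q) :
    (Ideal.span {f}).map (algebraMap Q Q') = Ideal.span {algebraMap Q Q' f} := by
  rw [Ideal.map_span, Set.image_singleton]

/-- The ring `Q'/fQ'` is the base change of the free module `Q'` along `Q → Q/f`. -/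
instance free_quotient_map_span_singleton [Module.Free Q Q'] (f : Q) :
    Module.Free (Q ⧸ Ideal.span {f}) (Q' ⧸ (Ideal.span {f}).map (algebraMap Q Q')) := by
  let e : QuotSMulTop f Q' ≃ₗ[Q] (Q' ⧸ (Ideal.span {f}).map (algebraMap Q Q')) :=
    Submodule.Quotient.equiv _ (((Ideal.span {f}).map (algebraMap Q Q')).restrictScalars Q)
      (LinearEquiv.refl Q Q') (by
        ext x
        simp [Ideal.map_algebraMap_span_singleton, Ideal.mem_span_singleton',
          Submodule.mem_smul_pointwise_iff_exists, Algebra.smul_def, mul_comm])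
  exact Module.Free.of_equiv
    (e.extendScalarsOfSurjective (S := Q ⧸ Ideal.span {f}) Ideal.Quotient.mk_surjective)

variable [IsLocalRing Q'] {f : Q} {J : Ideal Q'}
  [Algebra (Q' ⧸ (Ideal.span {f}).map (algebraMap Q Q')) (Q' ⧸ J)]
  [IsScalarTower Q' (Q' ⧸ (Ideal.span {f}).map (algebraMap Q Q')) (Q' ⧸ J)]
  [Module (Q ⧸ Ideal.span {f}) (Q' ⧸ J)]
  [IsScalarTower (Q ⧸ Ideal.span {f}) (Q' ⧸ (Ideal.span {f}).map (algebraMap Q Q')) (Q' ⧸ J)]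

/-- If `f ∈ 𝔪' J` is a nonzero-divisor, then `Q' / J` has infinite projective dimension over
`Q / f`. -/
theorem not_hasProjectiveDimensionLE_of_mem_maximalIdeal_mul [IsLocalRing Q]
    [IsNoetherianRing Q'] [Module.Free Q Q']
    (hm : (maximalIdeal Q).map (algebraMap Q Q') = maximalIdeal Q') (hf : f ∈ maximalIdeal Q)
    (hf0 : algebraMap Q Q' f ∈ nonZeroDivisors Q') (hJ : J ≠ ⊤)
    (hfJ : algebraMap Q Q' f ∈ maximalIdeal Q' * J) (n : ℕ) :
    ¬ HasProjectiveDimensionLE (ModuleCat.of (Q ⧸ Ideal.span {f}) (Q' ⧸ J)) n := by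
  intro hpd
  have hf' : algebraMap Q Q' f ∈ maximalIdeal Q' := hm ▸ Ideal.mem_map_of_mem _ hf
  have hspan := Ideal.map_algebraMap_span_singleton (Q' := Q') f
  have : Nontrivial (Q ⧸ Ideal.span {f}) := Ideal.Quotient.nontrivial_iff.2 <|
    ne_top_of_le_ne_top (maximalIdeal.isMaximal Q).ne_top
      ((Ideal.span_singleton_le_iff_mem _).2 hf)
  have : Nontrivial (Q' ⧸ (Ideal.span {f}).map (algebraMap Q Q')) :=
    Ideal.Quotient.nontrivial_iff.2 <| ne_top_of_le_ne_top (maximalIdeal.isMaximal Q').ne_top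
      (hspan ▸ (Ideal.span_singleton_le_iff_mem _).2 hf')
  have : Nontrivial (Q' ⧸ J) := Ideal.Quotient.nontrivial_iff.2 hJ
  have : IsLocalRing (Q ⧸ Ideal.span {f}) :=
    .of_surjective' _ Ideal.Quotient.mk_surjective
  have : IsLocalRing (Q' ⧸ (Ideal.span {f}).map (algebraMap Q Q')) :=
    .of_surjective' _ Ideal.Quotient.mk_surjective
  have hloc : IsLocalHom (Ideal.Quotient.mk ((Ideal.span {f}).map (algebraMap Q Q'))) :=
    .of_surjective _ Ideal.Quotient.mk_surjective
  have htower (x : Q') : algebraMap (Q' ⧸ (Ideal.span {f}).map (algebraMap Q Q')) (Q' ⧸ J)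
      (Ideal.Quotient.mk _ x) = Ideal.Quotient.mk J x :=
    (IsScalarTower.algebraMap_apply Q' _ (Q' ⧸ J) x).symm
  have hmax : (maximalIdeal (Q ⧸ Ideal.span {f})).map
      (algebraMap _ (Q' ⧸ (Ideal.span {f}).map (algebraMap Q Q'))) = maximalIdeal _ := by
    rw [← map_maximalIdeal_of_surjective _ (Ideal.Quotient.mk_surjective (I := Ideal.span {f})),
      ← map_maximalIdeal_of_surjective _ (Ideal.Quotient.mk_surjective
        (I := (Ideal.span {f}).map (algebraMap Q Q'))), Ideal.map_map, ← hm, Ideal.map_map]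
    rfl
  have hsurj : Function.Surjective
      (algebraMap (Q' ⧸ (Ideal.span {f}).map (algebraMap Q Q')) (Q' ⧸ J)) := fun y => by
    obtain ⟨x, rfl⟩ := Ideal.Quotient.mk_surjective y
    exact ⟨_, htower x⟩
  have : Module.Finite (Q' ⧸ (Ideal.span {f}).map (algebraMap Q Q')) (Q' ⧸ J) :=
    Module.Finite.of_surjective (Algebra.linearMap _ _) hsurj
  obtain ⟨ι, _, _, D, o, hD, hI, hK⟩ := Matrix.exists_mul_self_eq_scalar_of_mem_mul hfJ
  have hDD : D.map (Ideal.Quotient.mk ((Ideal.span {f}).map (algebraMap Q Q'))) *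
      D.map (Ideal.Quotient.mk ((Ideal.span {f}).map (algebraMap Q Q'))) = 0 := by
    rw [← Matrix.map_mul, hD]
    have h0 : Ideal.Quotient.mk ((Ideal.span {f}).map (algebraMap Q Q')) (algebraMap Q Q' f) = 0 :=
      Ideal.Quotient.eq_zero_iff_mem.2 (hspan ▸ Ideal.mem_span_singleton_self _)
    ext i j
    by_cases h : i = j <;> simp [h, h0]
  refine Matrix.not_exactOn_quotient (o := o) hsurj (fun j => ?_) (fun j => ?_)
    (Matrix.ExactOn.of_hasProjectiveDimensionLE hmax hDD
      (Matrix.ExactOn.quotient_of_mul_self_eq hf0 hD hspan) n (Q' ⧸ J) hpd)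
  · exact (map_mem_nonunits_iff
      (Ideal.Quotient.mk ((Ideal.span {f}).map (algebraMap Q Q'))) _).2 (hI j)
  · rw [Matrix.map_apply, htower]
    exact Ideal.Quotient.eq_zero_iff_mem.2 (hK j)

/-- If `J` is generated by a regular sequence and `f ∈ J \ 𝔪' J`, then `Q' / J` has finite
projective dimension over `Q / f`. -/
theorem exists_hasProjectiveDimensionLE_of_notMem_maximalIdeal_mul [IsNoetherianRing Q']
    [Module.Free Q Q'] {g : List Q'} (hg : IsRegular Q' g) (hJ : J = Ideal.ofList g)
    (hf : algebraMap Q Q' f ∈ J) (hf' : algebraMap Q Q' f ∉ maximalIdeal Q' * J) :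
    ∃ n, HasProjectiveDimensionLE (ModuleCat.of (Q ⧸ Ideal.span {f}) (Q' ⧸ J)) n := by
  have hspan := Ideal.map_algebraMap_span_singleton (Q' := Q') f
  obtain ⟨g', hreg, hgen⟩ := exists_isWeaklyRegular_cons_of_notMem hg (hJ ▸ hf) (hJ ▸ hf')
  have htower (x : Q') : algebraMap (Q' ⧸ (Ideal.span {f}).map (algebraMap Q Q')) (Q' ⧸ J)
      (Ideal.Quotient.mk _ x) = Ideal.Quotient.mk J x :=
    (IsScalarTower.algebraMap_apply Q' _ (Q' ⧸ J) x).symm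
  have hsurj : Function.Surjective
      (Algebra.linearMap (Q' ⧸ (Ideal.span {f}).map (algebraMap Q Q')) (Q' ⧸ J)) := fun y => by
    obtain ⟨x, rfl⟩ := Ideal.Quotient.mk_surjective y
    exact ⟨_, htower x⟩
  let e : QuotSMulTop (algebraMap Q Q' f) Q' ≃ₗ[Q']
      (Q' ⧸ (Ideal.span {f}).map (algebraMap Q Q')) :=
    Submodule.quotEquivOfEq _ _ (by
      rw [hspan, ← Submodule.ideal_span_singleton_smul, smul_eq_mul, Ideal.mul_top])
  have hreg' := (isWeaklyRegular_map_algebraMap_iff (S := Q' ⧸ (Ideal.span {f}).map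
    (algebraMap Q Q')) _ _).2
    ((e.isWeaklyRegular_congr g').1 ((isWeaklyRegular_cons_iff _ _ _).1 hreg).2)
  obtain ⟨m, hpd⟩ := exists_hasProjectiveDimensionLE_quotient_ofList_smul_top
    (A := Q ⧸ Ideal.span {f}) _ _ 0 hreg' <| by
      rw [← projective_iff_hasProjectiveDimensionLE_zero]
      exact (IsProjective.iff_projective _).1 inferInstance
  have hker : (Ideal.ofList (g'.map (algebraMap Q' (Q' ⧸ (Ideal.span {f}).map (algebraMap Q Q'))))
      • ⊤ : Submodule _ _) = LinearMap.ker (Algebra.linearMap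
        (Q' ⧸ (Ideal.span {f}).map (algebraMap Q Q')) (Q' ⧸ J)) := by
    have hmap : (Ideal.ofList g).map (Ideal.Quotient.mk ((Ideal.span {f}).map (algebraMap Q Q'))) =
        Ideal.ofList (g'.map (algebraMap Q' (Q' ⧸ (Ideal.span {f}).map (algebraMap Q Q')))) := by
      rw [← hgen, Ideal.map_ofList, List.map_cons, Ideal.ofList_cons,
        Ideal.Quotient.eq_zero_iff_mem.2 (hspan ▸ Ideal.mem_span_singleton_self _)]
      simp
    rw [smul_eq_mul, Ideal.mul_top, ← hmap]
    ext y
    obtain ⟨y, rfl⟩ := Ideal.Quotient.mk_surjective y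
    rw [LinearMap.mem_ker, Algebra.linearMap_apply, htower, Ideal.Quotient.eq_zero_iff_mem, ← hJ,
      ← Ideal.mem_comap, Ideal.comap_map_of_surjective' _ Ideal.Quotient.mk_surjective,
      Ideal.mk_ker, sup_eq_left.2]
    rw [hspan, Ideal.span_singleton_le_iff_mem]
    exact hf
  exact ⟨m, hasProjectiveDimensionLT_of_iso (((Submodule.quotEquivOfEq _ _ hker).trans
    (LinearMap.quotKerEquivOfSurjective _ hsurj)).restrictScalars
      (Q ⧸ Ideal.span {f})).toModuleIso _⟩

end Hypersurface

/-! ### The dichotomy and the cohomological support -/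

theorem pdHypersurface_targetModule_eq_top_iff {Q Q' : Type u} [CommRing Q] [CommRing Q']
    [IsLocalRing Q] [IsLocalRing Q'] [IsNoetherianRing Q'] [Algebra Q Q'] [Module.Free Q Q']
    (hm : (maximalIdeal Q).map (algebraMap Q Q') = maximalIdeal Q')
    {I : Ideal Q} {J : Ideal Q'} (hIJ : I ≤ J.comap (algebraMap Q Q'))
    {g : List Q'} (hg : IsRegular Q' g) (hJ : J = Ideal.ofList g) (f : I)
    (hf0 : algebraMap Q Q' f ∈ nonZeroDivisors Q') :
    pdHypersurface I f (targetModule hIJ) = ⊤ ↔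
      algebraMap Q Q' f ∈ maximalIdeal Q' * J := by
  have hfJ : algebraMap Q Q' f ∈ J := hIJ f.2
  have hJtop : J ≠ ⊤ := fun h => hg.top_ne_smul <| by rw [← hJ, h, Submodule.top_smul]
  have hf : (f : Q) ∈ maximalIdeal Q := fun h =>
    hJtop (Ideal.eq_top_of_isUnit_mem _ hfJ (h.map (algebraMap Q Q')))
  have hle : (Ideal.span {(f : Q)}).map (algebraMap Q Q') ≤ J := by
    rwa [Ideal.map_algebraMap_span_singleton, Ideal.span_singleton_le_iff_mem]
  let _ : Algebra (Q' ⧸ (Ideal.span {(f : Q)}).map (algebraMap Q Q')) (Q' ⧸ J) :=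
    (Ideal.Quotient.factor hle).toAlgebra
  have : IsScalarTower Q' (Q' ⧸ (Ideal.span {(f : Q)}).map (algebraMap Q Q')) (Q' ⧸ J) :=
    .of_algebraMap_eq fun _ => rfl
  -- This is the composite along which `pdHypersurface` and `targetModule` restrict scalars, so
  -- `hpd` below holds by `rfl`.
  let φ : Q ⧸ Ideal.span {(f : Q)} →+* Q' ⧸ J :=
    (Ideal.quotientMap J (algebraMap Q Q') hIJ).comp
      (Ideal.Quotient.factor ((Ideal.span_singleton_le_iff_mem I).2 f.2))
  let _ : Module (Q ⧸ Ideal.span {(f : Q)}) (Q' ⧸ J) := Module.compHom _ φ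
  have : IsScalarTower (Q ⧸ Ideal.span {(f : Q)})
      (Q' ⧸ (Ideal.span {(f : Q)}).map (algebraMap Q Q')) (Q' ⧸ J) := ⟨fun a b c => by
    obtain ⟨a, rfl⟩ := Ideal.Quotient.mk_surjective a
    have ha : algebraMap _ (Q' ⧸ J) (algebraMap _
        (Q' ⧸ (Ideal.span {(f : Q)}).map (algebraMap Q Q'))
          (Ideal.Quotient.mk (Ideal.span {(f : Q)}) a)) =
          φ (Ideal.Quotient.mk _ a) := rfl
    rw [Algebra.smul_def, Algebra.smul_def, Algebra.smul_def, map_mul, ha, mul_assoc]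
    rfl⟩
  have hpd : pdHypersurface I f (targetModule hIJ) =
      projectiveDimension (ModuleCat.of (Q ⧸ Ideal.span {(f : Q)}) (Q' ⧸ J)) := rfl
  rw [hpd, ← not_iff_not, ← ne_eq, projectiveDimension_ne_top_iff]
  exact ⟨fun ⟨n, hn⟩ h => not_hasProjectiveDimensionLE_of_mem_maximalIdeal_mul hm hf hf0 hJtop h n
    hn, fun h => exists_hasProjectiveDimensionLE_of_notMem_maximalIdeal_mul hg hJ hfJ h⟩

theorem VMap_cls_eq_zero_iff {Q Q' : Type u} [CommRing Q] [CommRing Q'] [IsLocalRing Q]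
    [IsLocalRing Q'] [Algebra Q Q'] {I : Ideal Q} {J : Ideal Q'}
    (hIJ : I ≤ J.comap (algebraMap Q Q'))
    (hm : (maximalIdeal Q).map (algebraMap Q Q') = maximalIdeal Q') (f : I) :
    VMap hIJ hm (VSpace.cls f) = 0 ↔ algebraMap Q Q' f ∈ maximalIdeal Q' * J := by
  have h : (maximalIdeal Q' • ⊤ : Submodule Q' J).map J.subtype = maximalIdeal Q' * J := by
    rw [Submodule.map_smul'', Submodule.map_top, Submodule.range_subtype, smul_eq_mul]
  refine (Submodule.Quotient.mk_eq_zero _).trans ?_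
  rw [← h]
  exact ⟨fun h => ⟨idealMap hIJ f, h, rfl⟩, fun ⟨y, hy, e⟩ =>
    (Subtype.ext e : y = idealMap hIJ f) ▸ hy⟩

theorem lemma2p6 {Q Q' : Type u} [CommRing Q] [CommRing Q']
    [IsRegularLocalRing Q] [IsRegularLocalRing Q']
    [Algebra Q Q'] [Module.Finite Q Q'] [Module.Flat Q Q']
    (hm : (IsLocalRing.maximalIdeal Q).map (algebraMap Q Q') = IsLocalRing.maximalIdeal Q')
    (I : Ideal Q) (J : Ideal Q') (hIJ : I ≤ J.comap (algebraMap Q Q'))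
    (hJ : ∃ g : List Q', RingTheory.Sequence.IsRegular Q' g ∧ J = Ideal.ofList g) :
    cohomologicalSupport I (targetModule hIJ) = (LinearMap.ker (VMap hIJ hm) : Set (VSpace I)) ∧
    ∀ f : I, (f : Q) ≠ 0 →
      (pdHypersurface I f (targetModule hIJ) = ⊤ ↔
        algebraMap Q Q' f ∈ IsLocalRing.maximalIdeal Q' * J) := by
  obtain ⟨g, hg, hJg⟩ := hJ
  have : IsDomain Q' := IsRegularLocalRing.isDomain Q'
  have : Module.Free Q Q' := Module.free_of_flat_of_isLocalRing
  have hpd (f : I) (hf : (f : Q) ≠ 0) : pdHypersurface I f (targetModule hIJ) = ⊤ ↔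
      algebraMap Q Q' f ∈ maximalIdeal Q' * J :=
    pdHypersurface_targetModule_eq_top_iff hm hIJ hg hJg f <| mem_nonZeroDivisors_of_ne_zero <|
      (map_ne_zero_iff _ (FaithfulSMul.algebraMap_injective Q Q')).2 hf
  refine ⟨?_, hpd⟩
  have hnt : Nontrivial (targetModule hIJ) := Ideal.Quotient.nontrivial_iff.2 fun h =>
    hg.top_ne_smul <| by rw [← hJg, h, Submodule.top_smul]
  ext v
  obtain ⟨f, rfl⟩ : ∃ f : I, VSpace.cls f = v := Submodule.Quotient.mk_surjective _ v
  rw [SetLike.mem_coe, LinearMap.mem_ker]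
  constructor
  · rintro ⟨-, ⟨f', hf', htop⟩ | h0⟩
    · rw [← hf', VMap_cls_eq_zero_iff]
      -- The dichotomy excludes `f' = 0`, but its image `0` lies in `𝔪'J` anyway.
      by_cases h : (f' : Q) = 0
      · simp [h]
      · exact (hpd f' h).1 htop
    · rw [h0, map_zero]
  · intro h
    refine ⟨hnt, ?_⟩
    by_cases h0 : (f : Q) = 0
    · have h0' : f = 0 := Subtype.ext h0
      exact Or.inr (h0' ▸ rfl)
    · exact Or.inl ⟨f, rfl, (hpd f h0).2 ((VMap_cls_eq_zero_iff hIJ hm f).1 h)⟩
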